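/- **Setting.** An instance of unweighted online bipartite matching is a finite bipartite graph $G=(L,R,E)$, $E\subseteq L\times R$. The offline vertices $L$ are known in advance. The online vertices $j\in R$ arrive one at a time in an arbitrary order, and on arrival $j$ reveals its neighbourhood $N(j)\subseteq L$. The algorithm then immediately and irrevocably either leaves $j$ unmatched or matches $j$ to some $i\in N(j)$. An offline vertex may be matched several times but counts only once, so the objective value is the number of offline vertices that are matched at least once. A randomized algorithm is *$\Gamma$-competitive* if on every instance its expected objective value is at least $\Gamma$ times the size of a maximum matching of $G$. **Online Correlated Selection (OCS).** The OCS keeps a state $\tau_i\in\{\text{matched},\text{unmatched},\text{unknown}\}$ for every $i\in L$, initially unknown. When it is called with two distinct candidates $i_1,i_2\in L$, it uses fresh random bits as follows. For $\ell\in\{1,2\}$ write $-\ell=3-\ell$. - With probability $\frac12$ (oblivious step): draw $\ell,m\in\{1,2\}$ independently and uniformly; set $\tau_{i_{-m}}$ to unknown; set $\tau_{i_m}$ to matched if $m=\ell$ and to unmatched otherwise. - Otherwise (adaptive step): draw $m\in\{1,2\}$ uniformly; if $\tau_{i_m}$ is matched let $\ell=-m$, if $\tau_{i_m}$ is unmatched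 let $\ell=m$, and if $\tau_{i_m}$ is unknown draw $\ell\in\{1,2\}$ uniformly; then set $\tau_{i_1}$ and $\tau_{i_2}$ to unknown. In both cases the OCS returns $i_\ell$. **Two-choice greedy with OCS.** For each $i\in L$ the algorithm keeps $k_i\in\{0,1,2,\dots\}\cup\{\infty\}$, initially $0$. On the arrival of $j\in R$, let $B(j)$ be the set of those $i\in N(j)$ with the smallest finite value $k_i$ among the neighbours of $j$ (empty if no neighbour has a finite value). - If $|B(j)|\ge2$ (randomized round), choose two distinct candidates $i_1,i_2\in B(j)$ by a fixed rule (for example lexicographically), which may depend on the arrivals so far but not on the random bits of the algorithm; match $j$ to the candidate returned by the OCS for $i_1,i_2$; and increase both $k_{i_1}$ and $k_{i_2}$ by $1$. - If $B(j)=\{i\}$ (deterministic round), match $j$ to $i$ and set $k_i=\infty$. - If $B(j)=\emptyset$ (unmatched round), leave $j$ unmatched. **Theorem.** For every such rule for choosing candidates, two-choice greedy with its randomized rounds carried out by the OCS is $0.505$-competitive for unweighted online bipartite matching. -/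

import Mathlib

open scoped ENNReal

/-- An instance of online bipartite matching with offline (left-hand-side) vertices `L`, online
(right-hand-side) vertices `R`, edge set `E ⊆ L × R`, and an order of arrival, which lists every
online vertex exactly once (so that `R` is finite). -/
structure OnlineInstance (L R : Type*) where
  E : Finset (L × R)
  arrival : List R
  arrival_nodup : arrival.Nodup
  mem_arrival : ∀ j : R, j ∈ arrival

namespace OnlineInstance

variable {L R : Type*} [Fintype L] [DecidableEq L] [DecidableEq R]

/-- The set `N(j)` of offline neighbours of the online vertex `j`. -/
def nbr (I : OnlineInstance L R) (j : R) : Finset L :=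
  Finset.univ.filter fun i => (i, j) ∈ I.E

/-- What an online algorithm is shown, in this order: every online vertex together with
its neighbours, at its arrival. -/
def arrivals (I : OnlineInstance L R) : List (R × Finset L) :=
  I.arrival.map fun j => (j, I.nbr j)

/-- A matching: a set of edges, no two of which share an endpoint. -/
def IsMatching (I : OnlineInstance L R) (M : Finset (L × R)) : Prop :=
  M ⊆ I.E ∧ ∀ e ∈ M, ∀ e' ∈ M, (e.1 = e'.1 ∨ e.2 = e'.2) → e = e'

open Classical in
/-- The offline optimum: the size of a maximum matching. -/
noncomputable def opt (I : OnlineInstance L R) : ℕ :=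
  (I.E.powerset.filter I.IsMatching).sup Finset.card

end OnlineInstance

section Competitive

variable {L R : Type*} [Fintype L] [DecidableEq L] [DecidableEq R]

/-- The objective value of a set of matched pairs: the number of matched offline vertices. An
offline vertex that is matched several times counts once. -/
def objective (A : Finset (L × R)) : ℕ := (A.image Prod.fst).card

/-- The expected objective value of a random set of matched pairs. -/
noncomputable def expectedObjective (p : PMF (Finset (L × R))) : ℝ≥0∞ :=
  ∑' A, p A * (objective A : ℝ≥0∞)

/-- A randomized online algorithm, given as the distribution of the set of pairs it has matched
after a sequence of arrivals, is `Γ`-competitive if on every instance its expected objective value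
is at least `Γ` times the size of a maximum matching. -/
def IsCompetitive (alg : List (R × Finset L) → PMF (Finset (L × R))) (Γ : ℝ) : Prop :=
  ∀ I : OnlineInstance L R,
    ENNReal.ofReal Γ * (I.opt : ℝ≥0∞) ≤ expectedObjective (alg I.arrivals)

end Competitive

/-- The state that the OCS subroutine keeps for an offline vertex. -/
inductive OCSStatus
  | matched
  | unmatched
  | unknown

/-- A fair coin. -/
noncomputable def fairCoin : PMF Bool := PMF.uniformOfFintype Bool

/-- One call of Online Correlated Selection with states `τ` on the pair of candidates
`c false`, `c true`: the distribution of the selected candidate and the new states. The indices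
`ℓ`, `m` of candidates are Booleans, and `!m` is the index other than `m`. -/
noncomputable def ocs {L : Type*} [DecidableEq L] (τ : L → OCSStatus) (c : Bool → L) :
    PMF (L × (L → OCSStatus)) :=
  fairCoin.bind fun oblivious =>
    if oblivious then
      fairCoin.bind fun ℓ => fairCoin.bind fun m =>
        PMF.pure (c ℓ,
          Function.update (Function.update τ (c (!m)) OCSStatus.unknown) (c m)
            (if m = ℓ then OCSStatus.matched else OCSStatus.unmatched))
    else
      fairCoin.bind fun m =>
        (match τ (c m) with
          | OCSStatus.matched => PMF.pure (!m)
          | OCSStatus.unmatched => PMF.pure m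
          | OCSStatus.unknown => fairCoin).bind fun ℓ =>
        PMF.pure (c ℓ,
          Function.update (Function.update τ (c false) OCSStatus.unknown) (c true)
            OCSStatus.unknown)

/-- A rule for choosing two distinct candidates out of a set `B` with at least two elements, for
instance lexicographically. It may depend on all arrivals so far (the list in the first argument,
the latest arrival last), but not on the random bits of the algorithm. -/
structure PairRule (L R : Type*) where
  pick : List (R × Finset L) → (B : Finset L) → 2 ≤ B.card → Bool → L
  pick_mem : ∀ h B hB b, pick h B hB b ∈ B
  pick_ne : ∀ h B hB, pick h B hB false ≠ pick h B hB true

/-- The state of two-choice greedy with OCS: the arrivals so far, the numbers `k i` of randomized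
rounds in which `i` has been a candidate (`⊤` once `i` has been chosen in a deterministic round),
the states `τ` of the OCS, and the set of pairs matched so far. -/
structure GreedyState (L R : Type*) where
  history : List (R × Finset L)
  k : L → ℕ∞
  τ : L → OCSStatus
  assigned : Finset (L × R)

section Greedy

variable {L R : Type*} [DecidableEq L] [DecidableEq R]

def GreedyState.init : GreedyState L R where
  history := []
  k := fun _ => 0
  τ := fun _ => OCSStatus.unknown
  assigned := ∅

/-- The set `B(j)` of those neighbours in `N = N(j)` with the smallest finite value `k i`. -/
noncomputable def bestNeighbours (k : L → ℕ∞) (N : Finset L) : Finset L :=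
  open Classical in N.filter fun i => k i ≠ ⊤ ∧ ∀ i' ∈ N, k i ≤ k i'

/-- One round of two-choice greedy with OCS, on the arrival of `a.1` with neighbours `a.2`. -/
noncomputable def greedyStep (rule : PairRule L R) (a : R × Finset L) (s : GreedyState L R) :
    PMF (GreedyState L R) :=
  let history := s.history ++ [a]
  let B := bestNeighbours s.k a.2
  open Classical in
  if hB : 2 ≤ B.card then
    -- randomized round: the OCS selects one of the two candidates
    let c := rule.pick history B hB
    (ocs s.τ c).bind fun r =>
      PMF.pure
        { history := history
          k := fun i => if i = c false ∨ i = c true then s.k i + 1 else s.k i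
          τ := r.2
          assigned := insert (r.1, a.1) s.assigned }
  else if h : B.Nonempty then
    -- deterministic round: `B` has exactly one element
    PMF.pure
      { history := history
        k := Function.update s.k h.choose ⊤
        τ := s.τ
        assigned := insert (h.choose, a.1) s.assigned }
  else
    -- unmatched round
    PMF.pure { s with history := history }

/-- The distribution of the state after a sequence of further arrivals, starting from `s`. -/
noncomputable def greedyRun (rule : PairRule L R) :
    List (R × Finset L) → GreedyState L R → PMF (GreedyState L R)
  | [], s => PMF.pure s
  | a :: as, s => (greedyStep rule a s).bind (greedyRun rule as)

/-- Two-choice greedy, with the randomized rounds carried out by the OCS: the distribution of the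
set of pairs that are matched after a sequence of arrivals. -/
noncomputable def twoChoiceGreedyOCS (rule : PairRule L R) (as : List (R × Finset L)) :
    PMF (Finset (L × R)) :=
  (greedyRun rule as GreedyState.init).map GreedyState.assigned

end Greedy

/-!
The theorem is proved by the primal-dual method, with `50 / 99 > 0.505` as the ratio.

The numbers `k i` of two-choice greedy do not depend on the random bits, so a run is determined,
up to the OCS, by the arrivals. Two estimates are combined.

*The OCS.* The probability that an offline vertex `i` with counter `k i = n ≥ 1` is unmatched is at
most `2⁻¹ * (15 / 32) ^ (n - 1)` (`survivalBound`), rather than the `2⁻ⁿ` of independent choices.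
The gain comes from an adaptive step that inspects `i` when an oblivious step has marked it as
`unmatched`: it is then certainly selected. Fix `i`, and let `P` and `U` be the probabilities that
`i` is unmatched, and that `i` is unmatched and marked so. A call with candidate `i` changes `P`
into `P' ≤ P / 2 - U / 8` and `U` into `U' = P / 8`. Hence `P' ≤ P / 2 = 4 * U'`, so after the first
call `P ≤ 4 * U` holds throughout and every later call multiplies `P` by at most
`1 / 2 - 1 / 32 = 15 / 32`. The bound on `P'` needs that the adaptive steps which inspect the other
candidate `v` do no harm, that is, over the event that `i` is unmatched, `v` is at least as likely
to be marked `matched` as `unmatched`. To be preserved by calls on other pairs, this comparison must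
hold for all values of the remaining statuses jointly; it is the last field of `VertexInvariant`,
where the statuses enter through test functions. `VertexInvariant.ocs_candidate` and
`VertexInvariant.ocs_of_ne` are the steps of the induction.

*The dual solution.* A vertex with counter `k` has the gain `1 - survivalBound k`, of which it keeps
`dualValue k` and passes `surplus k` on to the online vertices in whose rounds its counter rose.
The dual values are chosen such that in every round the surplus passed on is at least
`50 / 99 - dualValue (k' i)`, for each neighbour `i` of the arriving vertex with its new counter
`k' i` (`RoundStep.le_totalSurplus_sub`). Summed over the edges of a maximum matching,
this bounds `50 / 99` times its size by the guaranteed gain `∑ i, (1 - survivalBound (k i))`.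
-/

/-! ### Expectation over a discrete distribution -/

/-- The expectation of a nonnegative function under a discrete distribution. -/
noncomputable def PMF.expect {α : Type*} (p : PMF α) (f : α → ℝ≥0∞) : ℝ≥0∞ := ∑' a, p a * f a

namespace PMF

variable {α β : Type*}

lemma expect_pure (a : α) (f : α → ℝ≥0∞) : (PMF.pure a).expect f = f a := by
  unfold expect
  rw [tsum_eq_single a]
  · simp
  · intro b hb
    simp [hb]

lemma expect_bind (p : PMF α) (q : α → PMF β) (f : β → ℝ≥0∞) :
    (p.bind q).expect f = p.expect fun a => (q a).expect f := by
  unfold expect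
  simp only [PMF.bind_apply, ← ENNReal.tsum_mul_right, ← ENNReal.tsum_mul_left]
  rw [ENNReal.tsum_comm]
  simp only [mul_assoc]

lemma expect_map (p : PMF α) (g : α → β) (f : β → ℝ≥0∞) :
    (p.map g).expect f = p.expect fun a => f (g a) := by
  rw [PMF.map, expect_bind]
  simp [expect_pure]

lemma expect_congr {p : PMF α} {f g : α → ℝ≥0∞} (h : ∀ a ∈ p.support, f a = g a) :
    p.expect f = p.expect g := by
  unfold expect
  refine tsum_congr fun a => ?_
  by_cases ha : p a = 0
  · simp [ha]
  · rw [h a ((p.mem_support_iff a).2 ha)]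

lemma expect_mono (p : PMF α) {f g : α → ℝ≥0∞} (h : ∀ a, f a ≤ g a) :
    p.expect f ≤ p.expect g :=
  ENNReal.tsum_le_tsum fun a => by gcongr; exact h a

lemma expect_add (p : PMF α) (f g : α → ℝ≥0∞) :
    (p.expect fun a => f a + g a) = p.expect f + p.expect g := by
  simp only [expect, mul_add, ENNReal.tsum_add]

lemma expect_const_mul (p : PMF α) (c : ℝ≥0∞) (f : α → ℝ≥0∞) :
    (p.expect fun a => c * f a) = c * p.expect f := by
  simp only [expect, ← ENNReal.tsum_mul_left]
  exact tsum_congr fun a => by ring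

lemma expect_const (p : PMF α) (c : ℝ≥0∞) : (p.expect fun _ => c) = c := by
  simp only [expect, ENNReal.tsum_mul_right, p.tsum_coe, one_mul]

lemma expect_finset_sum {ι : Type*} (p : PMF α) (s : Finset ι) (f : ι → α → ℝ≥0∞) :
    (p.expect fun a => ∑ i ∈ s, f i a) = ∑ i ∈ s, p.expect (f i) := by
  classical
  induction s using Finset.induction_on with
  | empty => simp [expect]
  | insert i s hi ih => simp only [Finset.sum_insert hi, expect_add, ih]

end PMF

lemma fairCoin_expect (f : Bool → ℝ≥0∞) :
    fairCoin.expect f = 2⁻¹ * (f true + f false) := by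
  simp [PMF.expect, fairCoin, mul_add, add_comm]

/-! ### One call of the OCS, seen from a fixed offline vertex -/

section Ocs

variable {L : Type*} [DecidableEq L]

instance : DecidableEq OCSStatus := fun a b => by
  cases a <;> cases b <;> first | exact isTrue rfl | exact isFalse (by intro h; cases h)

/-- The states after an oblivious step in which candidate `c m` takes the status `x`. -/
def obliviousUpdate (τ : L → OCSStatus) (c : Bool → L) (m : Bool) (x : OCSStatus) :
    L → OCSStatus :=
  Function.update (Function.update τ (c (!m)) OCSStatus.unknown) (c m) x

/-- The states after an adaptive step. -/
def adaptiveUpdate (τ : L → OCSStatus) (c : Bool → L) : L → OCSStatus :=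
  Function.update (Function.update τ (c false) OCSStatus.unknown) (c true) OCSStatus.unknown

/-- The probability that an adaptive step which inspects a candidate of status `x` selects
the candidate it inspects. -/
noncomputable def selectInspected : OCSStatus → ℝ≥0∞
  | OCSStatus.matched => 0
  | OCSStatus.unmatched => 1
  | OCSStatus.unknown => 2⁻¹

/-- The probability that an adaptive step which inspects a candidate of status `x` selects
the other candidate. -/
noncomputable def selectOther : OCSStatus → ℝ≥0∞
  | OCSStatus.matched => 1
  | OCSStatus.unmatched => 0
  | OCSStatus.unknown => 2⁻¹

/-- The expectation of `φ` at the new states over the event that a call of the OCS does not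
select the vertex `i`. -/
noncomputable def ocsMiss (i : L) (c : Bool → L) (φ : (L → OCSStatus) → ℝ≥0∞)
    (τ : L → OCSStatus) : ℝ≥0∞ :=
  (ocs τ c).expect fun r => if r.1 = i then 0 else φ r.2

lemma ocsMiss_of_ne {i : L} {c : Bool → L} (hi : ∀ b, c b ≠ i) (φ : (L → OCSStatus) → ℝ≥0∞)
    (τ : L → OCSStatus) :
    ocsMiss i c φ τ = 2⁻¹ * (2⁻¹ * 2⁻¹ *
        (φ (obliviousUpdate τ c true .matched) + φ (obliviousUpdate τ c true .unmatched) +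
         φ (obliviousUpdate τ c false .matched) + φ (obliviousUpdate τ c false .unmatched))
      + φ (adaptiveUpdate τ c)) := by
  unfold ocsMiss ocs
  simp only [PMF.expect_bind, fairCoin_expect, if_true, Bool.false_eq_true, if_false,
    PMF.expect_pure, hi, PMF.expect_const]
  simp only [obliviousUpdate, adaptiveUpdate, Bool.not_false, Bool.not_true, reduceCtorEq,
    if_false]
  ring

lemma ocsMiss_candidate {c : Bool → L} (hc : c false ≠ c true) (b : Bool)
    (φ : (L → OCSStatus) → ℝ≥0∞) (τ : L → OCSStatus) :
    ocsMiss (c b) c φ τ = 2⁻¹ * (2⁻¹ * 2⁻¹ *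
        (φ (obliviousUpdate τ c b .unmatched) + φ (obliviousUpdate τ c (!b) .matched))
      + 2⁻¹ * (selectOther (τ (c b)) + selectInspected (τ (c !b))) * φ (adaptiveUpdate τ c)) := by
  unfold ocsMiss ocs
  simp only [PMF.expect_bind, fairCoin_expect, if_true, Bool.false_eq_true, if_false,
    PMF.expect_pure]
  cases b
  · simp only [hc.symm, if_true, if_false, obliviousUpdate, adaptiveUpdate, Bool.not_false,
      Bool.not_true]
    rcases τ (c false) <;> rcases τ (c true) <;>
      simp [PMF.expect_pure, fairCoin_expect, hc.symm, selectOther, selectInspected] <;> ring_nf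
  · simp only [hc, if_true, if_false, obliviousUpdate, adaptiveUpdate, Bool.not_false,
      Bool.not_true]
    rcases τ (c false) <;> rcases τ (c true) <;>
      simp [PMF.expect_pure, fairCoin_expect, hc, selectOther, selectInspected] <;> ring_nf

lemma ocsMiss_one {c : Bool → L} {i : L} (hi : ∀ b, c b ≠ i) (τ : L → OCSStatus) :
    ocsMiss i c (fun _ => 1) τ = 1 := by
  have h2 : (2⁻¹ : ℝ≥0∞) * 2 = 1 := ENNReal.inv_mul_cancel (by simp) (by simp)
  rw [ocsMiss_of_ne hi]
  calc _ = 2⁻¹ * ((2⁻¹ * 2) * (2⁻¹ * 2) + 1 : ℝ≥0∞) := by ring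
    _ = 1 := by rw [h2, one_mul, one_add_one_eq_two, h2]

end Ocs

/-! ### Survival bounds for an offline vertex -/

/-- The bound on the probability that an offline vertex `i` is still unmatched, as a function
of `k i`: it is `1` at `0`, `2⁻¹ * (15 / 32) ^ (n - 1)` at `n ≥ 1` and `0` at `⊤`. -/
noncomputable def survivalBound : ℕ∞ → ℝ :=
  ENat.recTopCoe 0 fun n => if n = 0 then 1 else 2⁻¹ * (15 / 32) ^ (n - 1)

lemma survivalBound_top : survivalBound ⊤ = 0 := rfl

lemma survivalBound_zero : survivalBound 0 = 1 := by
  simp [survivalBound]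

lemma survivalBound_one : survivalBound 1 = 2⁻¹ := by
  simp [survivalBound]

lemma survivalBound_add_one {k : ℕ∞} (h0 : k ≠ 0) :
    survivalBound (k + 1) = 15 / 32 * survivalBound k := by
  induction k using ENat.recTopCoe with
  | top => simp [survivalBound]
  | coe n =>
    have hn : n ≠ 0 := by exact_mod_cast h0
    obtain ⟨m, rfl⟩ := Nat.exists_eq_succ_of_ne_zero hn
    have h1 : survivalBound ((m.succ : ℕ∞) + 1) = 2⁻¹ * (15 / 32) ^ (m + 1) := rfl
    have h2 : survivalBound (m.succ : ℕ∞) = 2⁻¹ * (15 / 32) ^ m := rfl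
    rw [h1, h2]; ring

lemma survivalBound_nonneg (k : ℕ∞) : 0 ≤ survivalBound k := by
  induction k using ENat.recTopCoe with
  | top => exact le_rfl
  | coe n =>
    change 0 ≤ if n = 0 then (1 : ℝ) else _
    split_ifs <;> positivity

/-! ### How one call changes the comparison of statuses -/

section Ocs

variable {L : Type*} [DecidableEq L]

lemma obliviousUpdate_self (τ : L → OCSStatus) (c : Bool → L) (m : Bool) (x : OCSStatus) :
    obliviousUpdate τ c m x (c m) = x := by
  simp [obliviousUpdate]

lemma obliviousUpdate_other (τ : L → OCSStatus) {c : Bool → L} (hc : c false ≠ c true)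
    (m : Bool) (x : OCSStatus) : obliviousUpdate τ c m x (c !m) = .unknown := by
  cases m <;> simp [obliviousUpdate, hc, hc.symm]

lemma obliviousUpdate_of_ne (τ : L → OCSStatus) {c : Bool → L} {v : L} (hv : ∀ b, c b ≠ v)
    (m : Bool) (x : OCSStatus) : obliviousUpdate τ c m x v = τ v := by
  simp [obliviousUpdate, (hv _).symm]

lemma adaptiveUpdate_self (τ : L → OCSStatus) (c : Bool → L) (b : Bool) :
    adaptiveUpdate τ c (c b) = .unknown := by
  cases b
  · by_cases h : c false = c true <;> simp [adaptiveUpdate, h]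
  · simp [adaptiveUpdate]

lemma adaptiveUpdate_of_ne (τ : L → OCSStatus) {c : Bool → L} {v : L} (hv : ∀ b, c b ≠ v) :
    adaptiveUpdate τ c v = τ v := by
  simp [adaptiveUpdate, (hv _).symm]

/-- A function of the states that does not depend on the status of `v`. -/
def IgnoresStatus (v : L) (f : (L → OCSStatus) → ℝ≥0∞) : Prop :=
  ∀ τ x, f (Function.update τ v x) = f τ

lemma IgnoresStatus.obliviousUpdate_eq {c : Bool → L} {m : Bool} {f : (L → OCSStatus) → ℝ≥0∞}
    (hf : IgnoresStatus (c m) f) (τ : L → OCSStatus) (x y : OCSStatus) :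
    f (obliviousUpdate τ c m x) = f (obliviousUpdate τ c m y) := by
  simp only [obliviousUpdate, hf _ _]

lemma ocsMiss_indicator_of_ne {i v : L} {c : Bool → L} (hc : c false ≠ c true)
    (hv : ∀ b, c b ≠ v) (s : OCSStatus) (f : (L → OCSStatus) → ℝ≥0∞) (τ : L → OCSStatus) :
    ocsMiss i c (fun τ' => if τ' v = s then f τ' else 0) τ =
      if τ v = s then ocsMiss i c f τ else 0 := by
  by_cases hi : ∀ b, c b ≠ i
  · rw [ocsMiss_of_ne hi, ocsMiss_of_ne hi]
    simp only [obliviousUpdate_of_ne _ hv, adaptiveUpdate_of_ne _ hv]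
    split_ifs <;> simp
  · push Not at hi
    obtain ⟨b, rfl⟩ := hi
    rw [ocsMiss_candidate hc, ocsMiss_candidate hc]
    simp only [obliviousUpdate_of_ne _ hv, adaptiveUpdate_of_ne _ hv]
    split_ifs <;> simp

lemma obliviousUpdate_update_of_ne {c : Bool → L} {v : L} (hv : ∀ b, c b ≠ v)
    (τ : L → OCSStatus) (y : OCSStatus) (m : Bool) (x : OCSStatus) :
    obliviousUpdate (Function.update τ v y) c m x =
      Function.update (obliviousUpdate τ c m x) v y := by
  simp only [obliviousUpdate]
  rw [Function.update_comm (hv (!m)).symm, Function.update_comm (hv m).symm]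

lemma adaptiveUpdate_update_of_ne {c : Bool → L} {v : L} (hv : ∀ b, c b ≠ v)
    (τ : L → OCSStatus) (y : OCSStatus) :
    adaptiveUpdate (Function.update τ v y) c = Function.update (adaptiveUpdate τ c) v y := by
  simp only [adaptiveUpdate]
  rw [Function.update_comm (hv false).symm, Function.update_comm (hv true).symm]

lemma IgnoresStatus.ocsMiss {i v : L} {c : Bool → L} (hc : c false ≠ c true)
    (hv : ∀ b, c b ≠ v) {f : (L → OCSStatus) → ℝ≥0∞} (hf : IgnoresStatus v f) :
    IgnoresStatus v (ocsMiss i c f) := by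
  intro τ x
  by_cases hi : ∀ b, c b ≠ i
  · rw [ocsMiss_of_ne hi, ocsMiss_of_ne hi]
    simp only [obliviousUpdate_update_of_ne hv, adaptiveUpdate_update_of_ne hv, hf _ _]
  · push Not at hi
    obtain ⟨b, rfl⟩ := hi
    rw [ocsMiss_candidate hc, ocsMiss_candidate hc]
    simp only [obliviousUpdate_update_of_ne hv, adaptiveUpdate_update_of_ne hv, hf _ _,
      Function.update_of_ne (hv _)]

/-- A candidate `v ≠ i` becomes `matched` and `unmatched` with the same probability, unless `i` is
the other candidate; in that case missing `i` means selecting `v`, which rules out `unmatched`. -/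
lemma ocsMiss_unmatched_le_matched {i : L} {c : Bool → L} (hc : c false ≠ c true) (b : Bool)
    (hb : c b ≠ i) {f : (L → OCSStatus) → ℝ≥0∞} (hf : IgnoresStatus (c b) f)
    (τ : L → OCSStatus) :
    ocsMiss i c (fun τ' => if τ' (c b) = .unmatched then f τ' else 0) τ ≤
      ocsMiss i c (fun τ' => if τ' (c b) = .matched then f τ' else 0) τ := by
  by_cases hi : ∀ b, c b ≠ i
  · rw [ocsMiss_of_ne hi, ocsMiss_of_ne hi]
    cases b
    · have h1 := obliviousUpdate_other τ hc true
      simp only [Bool.not_true] at h1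
      simp [obliviousUpdate_self, adaptiveUpdate_self, h1,
        hf.obliviousUpdate_eq τ .unmatched .matched]
    · have h1 := obliviousUpdate_other τ hc false
      simp only [Bool.not_false] at h1
      simp [obliviousUpdate_self, adaptiveUpdate_self, h1,
        hf.obliviousUpdate_eq τ .unmatched .matched]
  · push Not at hi
    obtain ⟨d, rfl⟩ := hi
    obtain rfl : b = !d := by
      cases b <;> cases d <;> simp_all
    rw [ocsMiss_candidate hc, ocsMiss_candidate hc]
    simp [obliviousUpdate_self, adaptiveUpdate_self, obliviousUpdate_other _ hc]

/-- A call with candidate `i` that misses `i` marks it as `unmatched` with probability `1 / 8`,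
independently of the past. -/
lemma ocsMiss_candidate_unmatched {c : Bool → L} (hc : c false ≠ c true) (b : Bool)
    (τ : L → OCSStatus) :
    ocsMiss (c b) c (fun τ' => if τ' (c b) = .unmatched then 1 else 0) τ = 8⁻¹ := by
  have h := obliviousUpdate_other τ hc (!b) .matched
  rw [Bool.not_not] at h
  rw [ocsMiss_candidate hc]
  simp only [obliviousUpdate_self, adaptiveUpdate_self, h, reduceCtorEq, if_true, if_false,
    mul_zero, add_zero, mul_one]
  rw [← ENNReal.mul_inv (by simp) (by simp), ← ENNReal.mul_inv (by simp) (by simp)]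
  norm_num

lemma ocsMiss_candidate_matched {c : Bool → L} (hc : c false ≠ c true) (b : Bool)
    (τ : L → OCSStatus) :
    ocsMiss (c b) c (fun τ' => if τ' (c b) = .matched then 1 else 0) τ = 0 := by
  have h := obliviousUpdate_other τ hc (!b) .matched
  rw [Bool.not_not] at h
  rw [ocsMiss_candidate hc]
  simp [obliviousUpdate_self, adaptiveUpdate_self, h]

/-- The probability that a call with candidates `i = c b` and `v = c (!b)` misses `i` is `1 / 2`,
corrected by `1 / 8` for each informative status of `i` and of `v`. -/
lemma ocsMiss_candidate_one {c : Bool → L} (hc : c false ≠ c true) (b : Bool)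
    (τ : L → OCSStatus) :
    ocsMiss (c b) c (fun _ => 1) τ
        + 8⁻¹ * (if τ (c b) = .unmatched then 1 else 0)
        + 8⁻¹ * (if τ (c !b) = .matched then 1 else 0) =
      2⁻¹ + 8⁻¹ * (if τ (c b) = .matched then 1 else 0)
        + 8⁻¹ * (if τ (c !b) = .unmatched then 1 else 0) := by
  have h2 : (2⁻¹ : ℝ≥0∞) = ENNReal.ofReal (1 / 2) := by
    rw [ENNReal.ofReal_div_of_pos (by norm_num)]; simp
  have h8 : (8⁻¹ : ℝ≥0∞) = ENNReal.ofReal (1 / 8) := by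
    rw [ENNReal.ofReal_div_of_pos (by norm_num)]; simp
  have h1 : (1 : ℝ≥0∞) = ENNReal.ofReal 1 := by simp
  rw [ocsMiss_candidate hc, h2, h8]
  rcases τ (c b) <;> rcases τ (c !b) <;>
    simp only [selectOther, selectInspected, reduceCtorEq, if_true, if_false, mul_zero,
      add_zero, zero_add] <;>
    rw [h1] <;> try rw [h2]
  all_goals
    repeat first
      | rw [← ENNReal.ofReal_add (by norm_num) (by norm_num)]
      | rw [← ENNReal.ofReal_mul (by norm_num)]
    norm_num
  rw [← ENNReal.ofReal_mul (by norm_num), ← ENNReal.ofReal_add (by norm_num) (by norm_num),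
    ← ENNReal.ofReal_add (by norm_num) (by norm_num)]
  norm_num

end Ocs

/-! ### The invariant of an offline vertex -/

section Invariant

variable {L R : Type*} [DecidableEq L]

/-- The expectation of `φ` at the states of the OCS, over the event that `i` is unmatched. -/
noncomputable def missExpect (i : L) (μ : PMF (GreedyState L R))
    (φ : (L → OCSStatus) → ℝ≥0∞) : ℝ≥0∞ :=
  μ.expect fun s => if i ∈ s.assigned.image Prod.fst then 0 else φ s.τ

lemma missExpect_add (i : L) (μ : PMF (GreedyState L R)) (φ ψ : (L → OCSStatus) → ℝ≥0∞) :
    missExpect i μ (fun τ => φ τ + ψ τ) = missExpect i μ φ + missExpect i μ ψ := by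
  unfold missExpect
  rw [← PMF.expect_add]
  congr 1 with s
  split_ifs <;> simp

lemma missExpect_const_mul (i : L) (μ : PMF (GreedyState L R)) (a : ℝ≥0∞)
    (φ : (L → OCSStatus) → ℝ≥0∞) :
    missExpect i μ (fun τ => a * φ τ) = a * missExpect i μ φ := by
  unfold missExpect
  rw [← PMF.expect_const_mul]
  congr 1 with s
  split_ifs <;> simp

lemma missExpect_const (i : L) (μ : PMF (GreedyState L R)) (a : ℝ≥0∞) :
    missExpect i μ (fun _ => a) = a * missExpect i μ fun _ => 1 := by
  rw [← missExpect_const_mul]; simp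

lemma missExpect_mono (i : L) (μ : PMF (GreedyState L R)) {φ ψ : (L → OCSStatus) → ℝ≥0∞}
    (h : ∀ τ, φ τ ≤ ψ τ) : missExpect i μ φ ≤ missExpect i μ ψ := by
  refine PMF.expect_mono _ fun s => ?_
  split_ifs
  · exact le_rfl
  · exact h _

lemma missExpect_one_le (i : L) (μ : PMF (GreedyState L R)) :
    missExpect i μ (fun _ => 1) ≤ 1 := by
  refine (PMF.expect_mono _ fun s => ?_).trans_eq (PMF.expect_const μ 1)
  split_ifs <;> simp

lemma missExpect_status_ne_top (i : L) (μ : PMF (GreedyState L R)) (v : L) (s : OCSStatus) :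
    (missExpect i μ fun τ => if τ v = s then 1 else 0) ≠ ∞ :=
  ne_top_of_le_ne_top ENNReal.one_ne_top <|
    (missExpect_mono _ _ fun τ => by split_ifs <;> simp).trans (missExpect_one_le i μ)

/-- The invariant of the offline vertex `i` along a run, where `k` is the current value of `k i`. -/
structure VertexInvariant (μ : PMF (GreedyState L R)) (i : L) (k : ℕ∞) : Prop where
  /-- The probability that `i` is unmatched is at most the survival bound. -/
  unmatched_le : missExpect i μ (fun _ => 1) ≤ ENNReal.ofReal (survivalBound k)
  /-- Once `i` has been a candidate, the OCS knows that `i` is unmatched in at least a quarter of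
  the event that it is. -/
  le_known : k ≠ 0 → missExpect i μ (fun _ => 1) ≤
    4 * missExpect i μ fun τ => if τ i = .unmatched then 1 else 0
  /-- A vertex with status `matched` has been matched. -/
  not_matched : (missExpect i μ fun τ => if τ i = .matched then 1 else 0) = 0
  /-- Over the event that `i` is unmatched, every other vertex is at least as likely to have
  status `matched` as `unmatched`, whatever the statuses of the remaining vertices. -/
  le_matched : ∀ v ≠ i, ∀ f, IgnoresStatus v f →
    (missExpect i μ fun τ => if τ v = .unmatched then f τ else 0) ≤
      missExpect i μ fun τ => if τ v = .matched then f τ else 0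

variable {μ μ' : PMF (GreedyState L R)} {i : L} {k : ℕ∞}

lemma VertexInvariant.init :
    VertexInvariant (PMF.pure (GreedyState.init : GreedyState L R)) i 0 where
  unmatched_le := by simpa [survivalBound_zero] using missExpect_one_le i _
  le_known h := absurd rfl h
  not_matched := by simp [missExpect, PMF.expect_pure, GreedyState.init]
  le_matched v _ f _ := by simp [missExpect, PMF.expect_pure, GreedyState.init]

lemma VertexInvariant.of_missExpect_eq (h : VertexInvariant μ i k)
    (heq : ∀ φ, missExpect i μ' φ = missExpect i μ φ) : VertexInvariant μ' i k where
  unmatched_le := by simpa only [heq] using h.unmatched_le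
  le_known := by simpa only [heq] using h.le_known
  not_matched := by simpa only [heq] using h.not_matched
  le_matched := by simpa only [heq] using h.le_matched

lemma VertexInvariant.of_missExpect_eq_zero (heq : ∀ φ, missExpect i μ φ = 0) :
    VertexInvariant μ i k where
  unmatched_le := by simp [heq]
  le_known := by simp [heq]
  not_matched := heq _
  le_matched := by simp [heq]

lemma VertexInvariant.le_matched_ocs (h : VertexInvariant μ i k) {c : Bool → L}
    (hc : c false ≠ c true)
    (hstep : ∀ φ, missExpect i μ' φ = missExpect i μ (ocsMiss i c φ)) {v : L} (hv : v ≠ i)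
    {f : (L → OCSStatus) → ℝ≥0∞} (hf : IgnoresStatus v f) :
    (missExpect i μ' fun τ => if τ v = .unmatched then f τ else 0) ≤
      missExpect i μ' fun τ => if τ v = .matched then f τ else 0 := by
  rw [hstep, hstep]
  by_cases hvc : ∀ b, c b ≠ v
  · simp only [funext (ocsMiss_indicator_of_ne hc hvc _ f)]
    exact h.le_matched v hv _ (hf.ocsMiss hc hvc)
  · push Not at hvc
    obtain ⟨b, rfl⟩ := hvc
    exact missExpect_mono _ _ fun τ => ocsMiss_unmatched_le_matched hc b hv hf τ

lemma VertexInvariant.ocs_of_ne (h : VertexInvariant μ i k) {c : Bool → L}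
    (hc : c false ≠ c true)
    (hstep : ∀ φ, missExpect i μ' φ = missExpect i μ (ocsMiss i c φ)) (hi : ∀ b, c b ≠ i) :
    VertexInvariant μ' i k := by
  have h1 : missExpect i μ' (fun _ => 1) = missExpect i μ (fun _ => 1) := by
    rw [hstep, funext (ocsMiss_one hi)]
  have hs : ∀ s, (missExpect i μ' fun τ => if τ i = s then 1 else 0) =
      missExpect i μ fun τ => if τ i = s then 1 else 0 := fun s => by
    rw [hstep, funext (ocsMiss_indicator_of_ne hc hi s _)]
    simp only [ocsMiss_one hi]
  exact
    { unmatched_le := h1 ▸ h.unmatched_le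
      le_known := fun hk => by rw [h1, hs]; exact h.le_known hk
      not_matched := by rw [hs]; exact h.not_matched
      le_matched := fun v hv f hf => h.le_matched_ocs hc hstep hv hf }

lemma VertexInvariant.ocs_candidate {c : Bool → L} {b : Bool} (h : VertexInvariant μ (c b) k)
    (hc : c false ≠ c true)
    (hstep : ∀ φ, missExpect (c b) μ' φ = missExpect (c b) μ (ocsMiss (c b) c φ)) :
    VertexInvariant μ' (c b) (k + 1) := by
  have hne : c (!b) ≠ c b := by cases b <;> simp [hc, hc.symm]
  have hU : (missExpect (c b) μ' fun τ => if τ (c b) = .unmatched then 1 else 0) =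
      8⁻¹ * missExpect (c b) μ fun _ => 1 := by
    rw [hstep, funext (ocsMiss_candidate_unmatched hc b), missExpect_const]
  have hfin := missExpect_status_ne_top (c b) μ
  -- the informative statuses of the other candidate can only help
  have hmain : missExpect (c b) μ' (fun _ => 1) +
      8⁻¹ * (missExpect (c b) μ fun τ => if τ (c b) = .unmatched then 1 else 0) ≤
      2⁻¹ * missExpect (c b) μ fun _ => 1 := by
    have hsum := congrArg (missExpect (c b) μ) (funext (ocsMiss_candidate_one hc b))
    simp only [missExpect_add, missExpect_const_mul, ← hstep, h.not_matched, mul_zero,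
      add_zero] at hsum
    rw [missExpect_const _ _ 2⁻¹] at hsum
    have hle := h.le_matched (c !b) hne (fun _ => 1) fun _ _ => rfl
    refine (ENNReal.add_le_add_iff_right
      (ENNReal.mul_ne_top (a := 8⁻¹) (by simp) (hfin _ _))).1 (hsum.trans_le ?_)
    gcongr
  have hhalf : missExpect (c b) μ' (fun _ => 1) ≤ 2⁻¹ * missExpect (c b) μ fun _ => 1 :=
    le_self_add.trans hmain
  refine ⟨?_, fun _ => ?_, ?_, fun v hv f hf => h.le_matched_ocs hc hstep hv hf⟩
  · by_cases hk : k = 0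
    · subst hk
      rw [zero_add, survivalBound_one, ENNReal.ofReal_inv_of_pos (by norm_num)]
      refine hhalf.trans ((mul_le_of_le_one_right' (missExpect_one_le _ _)).trans_eq (by simp))
    · rw [survivalBound_add_one hk, ENNReal.ofReal_mul (by norm_num)]
      have hkn := h.le_known hk
      have hP := h.unmatched_le
      have hP1 := missExpect_one_le (c b) μ
      have hP2 := missExpect_one_le (c b) μ'
      have hU1 := hfin (c b) .unmatched
      refine le_trans ?_ (mul_le_mul_right hP _)
      generalize missExpect (c b) μ (fun _ => 1) = P at *
      generalize missExpect (c b) μ' (fun _ => 1) = P' at *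
      generalize (missExpect (c b) μ fun τ => if τ (c b) = .unmatched then 1 else 0) = U at *
      have hP1' := ne_top_of_le_ne_top ENNReal.one_ne_top hP1
      have hP2' := ne_top_of_le_ne_top ENNReal.one_ne_top hP2
      lift P to NNReal using hP1'
      lift P' to NNReal using hP2'
      lift U to NNReal using hU1
      have e1 := ENNReal.toReal_mono (by finiteness) hmain
      have e2 := ENNReal.toReal_mono (by finiteness) hkn
      rw [ENNReal.toReal_add (by finiteness) (by finiteness)] at e1
      simp only [ENNReal.toReal_mul, ENNReal.toReal_inv, ENNReal.coe_toReal,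
        ENNReal.toReal_ofNat] at e1 e2
      rw [← ENNReal.ofReal_coe_nnreal, ← ENNReal.ofReal_coe_nnreal (p := P),
        ← ENNReal.ofReal_mul (by norm_num)]
      exact ENNReal.ofReal_le_ofReal (by linarith)
  · rw [hU, ← mul_assoc]
    refine hhalf.trans_eq ?_
    congr 1
    rw [show (8 : ℝ≥0∞) = 4 * 2 by norm_num, ENNReal.mul_inv (by simp) (by simp), ← mul_assoc,
      ENNReal.mul_inv_cancel (by simp) (by simp), one_mul]
  · rw [hstep, funext (ocsMiss_candidate_matched hc b), missExpect_const, zero_mul]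

end Invariant

/-! ### The rounds of two-choice greedy -/

section Rounds

variable {L R : Type*} [DecidableEq L]

lemma missExpect_bind (i : L) (μ : PMF (GreedyState L R))
    (q : GreedyState L R → PMF (GreedyState L R)) (φ : (L → OCSStatus) → ℝ≥0∞) :
    missExpect i (μ.bind q) φ = μ.expect fun s => missExpect i (q s) φ :=
  PMF.expect_bind _ _ _

/-- The invariant of a run: the arrivals so far and the numbers `k i` are not random, and every
offline vertex satisfies its own invariant. -/
structure RunInvariant (μ : PMF (GreedyState L R)) (h : List (R × Finset L)) (k : L → ℕ∞) :
    Prop where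
  history_eq : ∀ s ∈ μ.support, s.history = h
  k_eq : ∀ s ∈ μ.support, s.k = k
  vertex : ∀ i, VertexInvariant μ i (k i)

lemma RunInvariant.init :
    RunInvariant (PMF.pure (GreedyState.init : GreedyState L R)) [] (fun _ => 0) where
  history_eq s hs := by
    rw [PMF.mem_support_pure_iff] at hs; subst hs; rfl
  k_eq s hs := by
    rw [PMF.mem_support_pure_iff] at hs; subst hs; rfl
  vertex _ := VertexInvariant.init

variable [DecidableEq R]

/-- The numbers `k i` after a randomized round with candidates `c`. -/
def incrementCandidates (k : L → ℕ∞) (c : Bool → L) : L → ℕ∞ :=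
  fun i => if i = c false ∨ i = c true then k i + 1 else k i

/-- How one round with neighbours `N` can change the numbers `k i`. -/
inductive RoundStep (k : L → ℕ∞) (N : Finset L) : (L → ℕ∞) → Prop
  | randomized (c : Bool → L) (hc : c false ≠ c true) (hmem : ∀ b, c b ∈ bestNeighbours k N) :
      RoundStep k N (incrementCandidates k c)
  | deterministic (x : L) (hx : bestNeighbours k N = {x}) :
      RoundStep k N (Function.update k x ⊤)
  | unmatched (hB : bestNeighbours k N = ∅) : RoundStep k N k

lemma RunInvariant.step {μ : PMF (GreedyState L R)} {h : List (R × Finset L)} {k : L → ℕ∞}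
    (hμ : RunInvariant μ h k) (rule : PairRule L R) (a : R × Finset L) :
    ∃ k', RoundStep k a.2 k' ∧
      RunInvariant (μ.bind (greedyStep rule a)) (h ++ [a]) k' := by
  classical
  by_cases hB : 2 ≤ (bestNeighbours k a.2).card
  · set c := rule.pick (h ++ [a]) _ hB
    have hc : c false ≠ c true := rule.pick_ne _ _ _
    have hstep : ∀ s ∈ μ.support, greedyStep rule a s = (ocs s.τ c).bind fun r => PMF.pure
        { history := h ++ [a]
          k := incrementCandidates k c
          τ := r.2
          assigned := insert (r.1, a.1) s.assigned } := by
      intro s hs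
      have h1 := hμ.history_eq s hs
      have h2 := hμ.k_eq s hs
      obtain ⟨hist, k₀, τ, A⟩ := s
      simp only at h1 h2
      subst h1 h2
      simp only [greedyStep, dif_pos hB]
      rfl
    have hmiss : ∀ i φ, missExpect i (μ.bind (greedyStep rule a)) φ =
        missExpect i μ (ocsMiss i c φ) := by
      intro i φ
      rw [missExpect_bind]
      refine PMF.expect_congr fun s hs => ?_
      rw [hstep s hs, missExpect, PMF.expect_bind]
      simp only [PMF.expect_pure, Finset.image_insert, Finset.mem_insert]
      by_cases hi : i ∈ s.assigned.image Prod.fst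
      · simp only [hi, or_true, if_true, PMF.expect_const]
      · simp only [hi, or_false, if_false, ocsMiss, eq_comm]
    have hsupp : ∀ s ∈ (μ.bind (greedyStep rule a)).support,
        s.history = h ++ [a] ∧ s.k = incrementCandidates k c := by
      intro s hs
      rw [PMF.mem_support_bind_iff] at hs
      obtain ⟨t, ht, hs⟩ := hs
      rw [hstep t ht, PMF.mem_support_bind_iff] at hs
      obtain ⟨r, -, hs⟩ := hs
      rw [PMF.mem_support_pure_iff] at hs
      subst hs
      exact ⟨rfl, rfl⟩
    refine ⟨_, .randomized c hc fun b => rule.pick_mem _ _ _ _,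
      fun s hs => (hsupp s hs).1, fun s hs => (hsupp s hs).2, fun i => ?_⟩
    by_cases hi : ∀ b, c b ≠ i
    · have : incrementCandidates k c i = k i :=
        if_neg (by simpa [eq_comm] using And.intro (hi false) (hi true))
      rw [this]
      exact (hμ.vertex i).ocs_of_ne hc (hmiss i) hi
    · push Not at hi
      obtain ⟨b, rfl⟩ := hi
      have : incrementCandidates k c (c b) = k (c b) + 1 := if_pos (by cases b <;> simp)
      rw [this]
      exact (hμ.vertex _).ocs_candidate hc (hmiss _)
  by_cases hne : (bestNeighbours k a.2).Nonempty
  · set x := hne.choose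
    have hx : bestNeighbours k a.2 = {x} := by
      have hcard : (bestNeighbours k a.2).card = 1 := by
        have := hne.card_pos
        omega
      obtain ⟨y, hy⟩ := Finset.card_eq_one.1 hcard
      have hxy : x ∈ bestNeighbours k a.2 := hne.choose_spec
      rw [hy, Finset.mem_singleton] at hxy
      rw [hy, hxy]
    have hstep : ∀ s ∈ μ.support, greedyStep rule a s = PMF.pure
        { history := h ++ [a]
          k := Function.update k x ⊤
          τ := s.τ
          assigned := insert (x, a.1) s.assigned } := by
      intro s hs
      have h1 := hμ.history_eq s hs
      have h2 := hμ.k_eq s hs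
      obtain ⟨hist, k₀, τ, A⟩ := s
      simp only at h1 h2
      subst h1 h2
      simp only [greedyStep, dif_neg hB, dif_pos hne]
      rfl
    have hsupp : ∀ s ∈ (μ.bind (greedyStep rule a)).support,
        s.history = h ++ [a] ∧ s.k = Function.update k x ⊤ := by
      intro s hs
      rw [PMF.mem_support_bind_iff] at hs
      obtain ⟨t, ht, hs⟩ := hs
      rw [hstep t ht, PMF.mem_support_pure_iff] at hs
      subst hs
      exact ⟨rfl, rfl⟩
    refine ⟨_, .deterministic x hx,
      fun s hs => (hsupp s hs).1, fun s hs => (hsupp s hs).2, fun i => ?_⟩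
    have hmiss : ∀ φ, missExpect i (μ.bind (greedyStep rule a)) φ =
        μ.expect fun s => if i = x ∨ i ∈ s.assigned.image Prod.fst then 0 else φ s.τ := by
      intro φ
      rw [missExpect_bind]
      refine PMF.expect_congr fun s hs => ?_
      rw [hstep s hs, missExpect, PMF.expect_pure]
      simp only [Finset.image_insert, Finset.mem_insert]
    by_cases hi : i = x
    · exact .of_missExpect_eq_zero fun φ => by
        rw [hmiss]
        simp only [hi, true_or, if_true, PMF.expect_const]
    · rw [Function.update_of_ne hi]
      exact (hμ.vertex i).of_missExpect_eq fun φ => by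
        rw [hmiss]
        simp only [hi, false_or, missExpect]
  · have hstep : ∀ s ∈ μ.support, greedyStep rule a s = PMF.pure
        { s with history := h ++ [a] } := by
      intro s hs
      have h1 := hμ.history_eq s hs
      have h2 := hμ.k_eq s hs
      obtain ⟨hist, k₀, τ, A⟩ := s
      simp only at h1 h2
      subst h1 h2
      simp only [greedyStep, dif_neg hB, dif_neg hne]
    have hsupp : ∀ s ∈ (μ.bind (greedyStep rule a)).support,
        s.history = h ++ [a] ∧ s.k = k := by
      intro s hs
      rw [PMF.mem_support_bind_iff] at hs
      obtain ⟨t, ht, hs⟩ := hs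
      rw [hstep t ht, PMF.mem_support_pure_iff] at hs
      subst hs
      exact ⟨rfl, hμ.k_eq t ht⟩
    refine ⟨_, .unmatched (Finset.not_nonempty_iff_eq_empty.1 hne),
      fun s hs => (hsupp s hs).1, fun s hs => (hsupp s hs).2, fun i =>
        (hμ.vertex i).of_missExpect_eq fun φ => ?_⟩
    rw [missExpect_bind]
    refine PMF.expect_congr fun s hs => ?_
    rw [hstep s hs, missExpect, PMF.expect_pure]

end Rounds

/-! ### Dual values -/

lemma survivalBound_antitone : Antitone survivalBound := by
  have hstep : ∀ n : ℕ, survivalBound ((n + 1 : ℕ) : ℕ∞) ≤ survivalBound (n : ℕ∞) := by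
    intro n
    rcases eq_or_ne (n : ℕ∞) 0 with h | h
    · rw [Nat.cast_add_one, h, zero_add, survivalBound_one, survivalBound_zero]
      norm_num
    · rw [Nat.cast_add_one, survivalBound_add_one h]
      linarith [survivalBound_nonneg n]
  have hnat := antitone_nat_of_succ_le (f := fun n : ℕ => survivalBound n) hstep
  intro k k' hk
  induction k' using ENat.recTopCoe with
  | top => exact survivalBound_nonneg k
  | coe n' =>
    lift k to ℕ using ne_top_of_le_ne_top (ENat.natCast_ne_top n') hk
    exact hnat (by exact_mod_cast hk)

lemma survivalBound_le_half {k : ℕ∞} (hk : k ≠ 0) : survivalBound k ≤ 1 / 2 :=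
  (survivalBound_antitone (Order.one_le_iff_pos.2 (pos_iff_ne_zero.2 hk))).trans_eq
    (by rw [survivalBound_one]; norm_num)

/-- The dual value of an offline vertex with counter `k`. It rises from `0` to the
competitive ratio `50 / 99`; what it lacks to `50 / 99` is what a randomized round with candidates
of counter `k` pays to the online vertex. -/
noncomputable def dualValue (k : ℕ∞) : ℝ :=
  if k = 0 then 0 else 50 / 99 - 17 / 33 * survivalBound k

/-- The guaranteed gain of an offline vertex with counter `k`, less its dual value: the amount
that it has contributed to the dual values of online vertices. -/
noncomputable def surplus (k : ℕ∞) : ℝ := 1 - survivalBound k - dualValue k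

lemma surplus_zero : surplus 0 = 0 := by
  simp [surplus, dualValue, survivalBound_zero]

lemma dualValue_top : dualValue ⊤ = 50 / 99 := by
  simp [dualValue, survivalBound_top]

lemma dualValue_of_ne_zero {k : ℕ∞} (hk : k ≠ 0) :
    dualValue k = 50 / 99 - 17 / 33 * survivalBound k := if_neg hk

lemma dualValue_nonneg (k : ℕ∞) : 0 ≤ dualValue k := by
  rcases eq_or_ne k 0 with rfl | hk
  · simp [dualValue]
  · rw [dualValue_of_ne_zero hk]
    linarith [survivalBound_le_half hk]

lemma dualValue_le (k : ℕ∞) : dualValue k ≤ 50 / 99 := by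
  rcases eq_or_ne k 0 with rfl | hk
  · simp [dualValue]; norm_num
  · rw [dualValue_of_ne_zero hk]
    linarith [survivalBound_nonneg k]

lemma dualValue_mono : Monotone dualValue := by
  intro k k' h
  rcases eq_or_ne k 0 with rfl | hk
  · simpa [dualValue] using dualValue_nonneg k'
  · have hk' : k' ≠ 0 := fun h0 => hk (le_antisymm (h0 ▸ h) bot_le)
    rw [dualValue_of_ne_zero hk, dualValue_of_ne_zero hk']
    linarith [survivalBound_antitone h]

/-- The two candidates of a randomized round together pay what a neighbour with the same
counter needs. -/
lemma le_two_mul_surplus_sub (k : ℕ∞) :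
    50 / 99 - dualValue k ≤ 2 * (surplus (k + 1) - surplus k) := by
  rcases eq_or_ne k 0 with rfl | hk
  · rw [surplus_zero, zero_add, surplus, dualValue_of_ne_zero one_ne_zero, survivalBound_one]
    simp [dualValue]; norm_num
  · have hk1 : k + 1 ≠ 0 := by simp
    rw [surplus, surplus, dualValue_of_ne_zero hk, dualValue_of_ne_zero hk1,
      survivalBound_add_one hk]
    linarith

/-- A deterministic round pays what a neighbour with a larger counter needs. -/
lemma le_surplus_top_sub (k : ℕ∞) :
    50 / 99 - dualValue (k + 1) ≤ surplus ⊤ - surplus k := by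
  have hk1 : k + 1 ≠ 0 := by simp
  rw [surplus, dualValue_top, survivalBound_top, dualValue_of_ne_zero hk1]
  rcases eq_or_ne k 0 with rfl | hk
  · rw [surplus_zero, zero_add, survivalBound_one]; norm_num
  · rw [surplus, dualValue_of_ne_zero hk, survivalBound_add_one hk]
    linarith [survivalBound_nonneg k]

section Accounting

lemma mem_bestNeighbours {L : Type*} {k : L → ℕ∞} {N : Finset L} {i : L} :
    i ∈ bestNeighbours k N ↔ i ∈ N ∧ k i ≠ ⊤ ∧ ∀ i' ∈ N, k i ≤ k i' := by
  classical
  simp [bestNeighbours]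

variable {L R : Type*} [DecidableEq L]

lemma RoundStep.le {k k' : L → ℕ∞} {N : Finset L} (h : RoundStep k N k') : k ≤ k' := by
  intro i
  cases h with
  | randomized c hc hmem =>
    unfold incrementCandidates
    split_ifs
    · exact le_self_add
    · exact le_rfl
  | deterministic x hx =>
    by_cases hi : i = x
    · subst hi; simp
    · rw [Function.update_of_ne hi]
  | unmatched hB => exact le_rfl

variable [Fintype L]

/-- What remains of the gain guaranteed at the counters `k` when the offline vertices have
received their dual values. -/
noncomputable def totalSurplus (k : L → ℕ∞) : ℝ := ∑ i, surplus (k i)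

lemma totalSurplus_incrementCandidates (k : L → ℕ∞) {c : Bool → L} (hc : c false ≠ c true) :
    totalSurplus (incrementCandidates k c) - totalSurplus k =
      (surplus (k (c false) + 1) - surplus (k (c false))) +
        (surplus (k (c true) + 1) - surplus (k (c true))) := by
  rw [totalSurplus, totalSurplus, ← Finset.sum_sub_distrib,
    ← Finset.sum_subset (Finset.subset_univ {c false, c true}), Finset.sum_pair hc]
  · simp [incrementCandidates]
  · intro i _ hi
    have : ¬(i = c false ∨ i = c true) := by simpa using hi
    rw [incrementCandidates, if_neg this, sub_self]

lemma totalSurplus_update_top (k : L → ℕ∞) (x : L) :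
    totalSurplus (Function.update k x ⊤) - totalSurplus k = surplus ⊤ - surplus (k x) := by
  rw [totalSurplus, totalSurplus, ← Finset.sum_sub_distrib, Finset.sum_eq_single x]
  · simp
  · intro i _ hi
    rw [Function.update_of_ne hi, sub_self]
  · simp

/-- A round only adds to the total surplus. -/
lemma RoundStep.totalSurplus_le {k k' : L → ℕ∞} {N : Finset L} (h : RoundStep k N k') :
    totalSurplus k ≤ totalSurplus k' := by
  rw [← sub_nonneg]
  cases h with
  | randomized c hc hmem =>
    rw [totalSurplus_incrementCandidates k hc]
    linarith [le_two_mul_surplus_sub (k (c false)), le_two_mul_surplus_sub (k (c true)),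
      dualValue_le (k (c false)), dualValue_le (k (c true))]
  | deterministic x hx =>
    rw [totalSurplus_update_top]
    linarith [le_surplus_top_sub (k x), dualValue_le (k x + 1)]
  | unmatched hB => simp

/-- Approximate dual feasibility: the surplus that a round adds covers, for every neighbour `i`
of the arriving vertex, the part of `50 / 99` that the dual value of `i` leaves open. -/
lemma RoundStep.le_totalSurplus_sub {k k' : L → ℕ∞} {N : Finset L} (h : RoundStep k N k')
    {i : L} (hi : i ∈ N) : 50 / 99 - dualValue (k' i) ≤ totalSurplus k' - totalSurplus k := by
  have hle := dualValue_mono (h.le i)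
  cases h with
  | randomized c hc hmem =>
    have h0 := mem_bestNeighbours.1 (hmem false)
    have h1 := mem_bestNeighbours.1 (hmem true)
    have heq : k (c true) = k (c false) := le_antisymm (h1.2.2 _ h0.1) (h0.2.2 _ h1.1)
    rw [totalSurplus_incrementCandidates k hc, heq]
    linarith [le_two_mul_surplus_sub (k (c false)), dualValue_mono (h0.2.2 i hi)]
  | deterministic x hx =>
    rw [totalSurplus_update_top]
    by_cases hix : i = x
    · subst hix
      rw [Function.update_self, dualValue_top]
      linarith [le_surplus_top_sub (k i), dualValue_le (k i + 1)]
    · have hxm := mem_bestNeighbours.1 (hx ▸ Finset.mem_singleton_self x)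
      have hlt : k x < k i := by
        refine lt_of_le_of_ne (hxm.2.2 i hi) fun heq => hix ?_
        have : i ∈ bestNeighbours k N :=
          mem_bestNeighbours.2 ⟨hi, heq ▸ hxm.2.1, heq ▸ hxm.2.2⟩
        rwa [hx, Finset.mem_singleton] at this
      rw [Function.update_of_ne hix]
      linarith [le_surplus_top_sub (k x), dualValue_mono (Order.add_one_le_of_lt hlt)]
  | unmatched hB =>
    have htop : k i = ⊤ := by
      by_contra hne
      obtain ⟨x, hx, hmin⟩ := N.exists_min_image k ⟨i, hi⟩
      have : x ∈ bestNeighbours k N :=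
        mem_bestNeighbours.2 ⟨hx, ne_top_of_le_ne_top hne (hmin i hi), hmin⟩
      simp [hB] at this
    rw [htop, dualValue_top]
    simp

variable [DecidableEq R]

/-- A run keeps the invariant, and the surplus that it adds covers what the final dual values of
the offline endpoints leave open on any set `M` of arriving edges, at most one for each online
vertex. -/
lemma RunInvariant.run (rule : PairRule L R) (as : List (R × Finset L)) :
    ∀ {μ : PMF (GreedyState L R)} {h : List (R × Finset L)} {k : L → ℕ∞},
      RunInvariant μ h k → ∃ h' k', RunInvariant (μ.bind (greedyRun rule as)) h' k' ∧ k ≤ k' ∧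
        totalSurplus k ≤ totalSurplus k' ∧
        ∀ M : Finset (L × R), (∀ e ∈ M, ∀ e' ∈ M, e.2 = e'.2 → e = e') →
          (∀ e ∈ M, e.2 ∈ as.map Prod.fst) →
          (∀ e ∈ M, ∀ a ∈ as, a.1 = e.2 → e.1 ∈ a.2) →
          ∑ e ∈ M, (50 / 99 - dualValue (k' e.1)) ≤ totalSurplus k' - totalSurplus k := by
  induction as with
  | nil =>
    intro μ h k hμ
    refine ⟨h, k, ?_, le_rfl, le_rfl, fun M _ hM _ => ?_⟩
    · have : greedyRun rule [] = PMF.pure := rfl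
      rw [this, PMF.bind_pure]
      exact hμ
    · have : M = ∅ := Finset.eq_empty_of_forall_notMem fun e he => by simpa using hM e he
      simp [this]
  | cons a as ih =>
    intro μ h k hμ
    obtain ⟨k₁, hround, hμ₁⟩ := hμ.step rule a
    obtain ⟨h', k', hμ', hle, hsur, hsum⟩ := ih hμ₁
    refine ⟨h', k', ?_, hround.le.trans hle, hround.totalSurplus_le.trans hsur,
      fun M hM hM₁ hM₂ => ?_⟩
    · rw [PMF.bind_bind] at hμ'
      exact hμ'
    · rw [← Finset.sum_filter_add_sum_filter_not M (fun e => e.2 = a.1)]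
      have hfirst : ∑ e ∈ M with e.2 = a.1, (50 / 99 - dualValue (k' e.1)) ≤
          totalSurplus k₁ - totalSurplus k := by
        rcases (M.filter fun e => e.2 = a.1).eq_empty_or_nonempty with hemp | ⟨e, he⟩
        · rw [hemp, Finset.sum_empty]
          linarith [hround.totalSurplus_le]
        · have hsing : (M.filter fun e => e.2 = a.1) = {e} := by
            refine Finset.eq_singleton_iff_unique_mem.2 ⟨he, fun e' he' => ?_⟩
            rw [Finset.mem_filter] at he he'
            exact hM _ he'.1 _ he.1 (he'.2.trans he.2.symm)
          rw [hsing, Finset.sum_singleton]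
          rw [Finset.mem_filter] at he
          have hmem : e.1 ∈ a.2 := hM₂ e he.1 a (by simp) he.2.symm
          linarith [hround.le_totalSurplus_sub hmem, dualValue_mono (hle e.1)]
      have hrest := hsum (M.filter fun e => ¬e.2 = a.1)
        (fun e he e' he' =>
          hM e (Finset.mem_of_mem_filter e he) e' (Finset.mem_of_mem_filter e' he'))
        (fun e he => by
          rw [Finset.mem_filter] at he
          have := hM₁ e he.1
          rw [List.map_cons, List.mem_cons] at this
          exact this.resolve_left he.2)
        (fun e he b hb => hM₂ e (Finset.mem_of_mem_filter e he) b (List.mem_cons_of_mem a hb))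
      linarith

end Accounting

/-! ### The competitive ratio -/

lemma OnlineInstance.exists_isMatching_card_eq_opt {L R : Type*} (I : OnlineInstance L R) :
    ∃ M, I.IsMatching M ∧ M.card = I.opt := by
  classical
  have hne : (I.E.powerset.filter I.IsMatching).Nonempty :=
    ⟨∅, by simp [OnlineInstance.IsMatching]⟩
  obtain ⟨M, hM, heq⟩ := Finset.exists_mem_eq_sup _ hne Finset.card
  refine ⟨M, (Finset.mem_filter.1 hM).2, ?_⟩
  rw [OnlineInstance.opt, ← heq]

section Ratio

variable {L R : Type*} [Fintype L] [DecidableEq L]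

lemma objective_add_card_unmatched (A : Finset (L × R)) :
    (objective A : ℝ≥0∞) + ∑ i : L, (if i ∈ A.image Prod.fst then 0 else 1 : ℝ≥0∞) =
      Fintype.card L := by
  have h1 : (objective A : ℝ≥0∞) = ∑ i : L, (if i ∈ A.image Prod.fst then 1 else 0 : ℝ≥0∞) := by
    rw [Finset.sum_boole, objective, Finset.filter_mem_eq_inter, Finset.univ_inter]
  rw [h1, ← Finset.sum_add_distrib]
  have : ∀ i : L, ((if i ∈ A.image Prod.fst then 1 else 0 : ℝ≥0∞) +
      if i ∈ A.image Prod.fst then 0 else 1) = 1 := fun i => by split_ifs <;> simp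
  simp [this]

/-- The expected objective is at least the gain guaranteed by the survival bounds. -/
lemma RunInvariant.le_expect_objective {μ : PMF (GreedyState L R)} {h : List (R × Finset L)}
    {k : L → ℕ∞} (hμ : RunInvariant μ h k) :
    ENNReal.ofReal (∑ i, (1 - survivalBound (k i))) ≤
      μ.expect fun s => (objective s.assigned : ℝ≥0∞) := by
  have hsum : (μ.expect fun s => (objective s.assigned : ℝ≥0∞)) +
      ∑ i, missExpect i μ (fun _ => 1) = Fintype.card L := by
    simp only [missExpect]
    rw [← PMF.expect_finset_sum, ← PMF.expect_add]
    simp only [objective_add_card_unmatched, PMF.expect_const]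
  have hbound : ∑ i, missExpect i μ (fun _ => 1) ≤
      ENNReal.ofReal (∑ i, survivalBound (k i)) := by
    rw [ENNReal.ofReal_sum_of_nonneg fun i _ => survivalBound_nonneg _]
    exact Finset.sum_le_sum fun i _ => (hμ.vertex i).unmatched_le
  have hle : (Fintype.card L : ℝ≥0∞) ≤ (μ.expect fun s => (objective s.assigned : ℝ≥0∞)) +
      ENNReal.ofReal (∑ i, survivalBound (k i)) := hsum ▸ by gcongr
  rw [Finset.sum_sub_distrib, ENNReal.ofReal_sub _ (Finset.sum_nonneg fun i _ =>
    survivalBound_nonneg _)]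
  simpa using hle

end Ratio

theorem mainTheorem1 {L R : Type*} [Fintype L] [DecidableEq L] [DecidableEq R]
    (rule : PairRule L R) :
    IsCompetitive (twoChoiceGreedyOCS rule) 0.505 := by
  intro I
  obtain ⟨M, ⟨hME, hM⟩, hcard⟩ := I.exists_isMatching_card_eq_opt
  -- `k` lists the final values of the numbers `k i`, which do not depend on the random bits
  obtain ⟨h, k, hμ, -, -, hsum⟩ := RunInvariant.run rule I.arrivals RunInvariant.init
  rw [PMF.pure_bind] at hμ
  have hexp : expectedObjective (twoChoiceGreedyOCS rule I.arrivals) =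
      (greedyRun rule I.arrivals GreedyState.init).expect
        fun s => (objective s.assigned : ℝ≥0∞) :=
    PMF.expect_map _ _ _
  rw [hexp]
  refine le_trans ?_ hμ.le_expect_objective
  have hdual := hsum M (fun e he e' he' h => hM e he e' he' (Or.inr h))
    (fun e _ => by simpa [OnlineInstance.arrivals] using I.mem_arrival e.2)
    (fun e he a ha hae => by
      obtain ⟨j, -, rfl⟩ := List.mem_map.1 ha
      have hj : j = e.2 := hae
      subst hj
      simpa [OnlineInstance.nbr] using hME he)
  have hoff : ∑ e ∈ M, dualValue (k e.1) ≤ ∑ i, dualValue (k i) := by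
    rw [← Finset.sum_image (s := M) (g := Prod.fst) (f := fun i => dualValue (k i))
      fun e he e' he' h => hM e he e' he' (Or.inl h)]
    exact Finset.sum_le_sum_of_subset_of_nonneg (Finset.subset_univ _)
      fun i _ _ => dualValue_nonneg _
  have hopt : (50 / 99 : ℝ) * I.opt ≤ ∑ i, (1 - survivalBound (k i)) := by
    have hsplit : totalSurplus k = ∑ i, (1 - survivalBound (k i)) - ∑ i, dualValue (k i) := by
      rw [← Finset.sum_sub_distrib]; rfl
    have hzero : totalSurplus (fun _ : L => 0) = 0 := by simp [totalSurplus, surplus_zero]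
    rw [Finset.sum_sub_distrib, Finset.sum_const, nsmul_eq_mul, hcard, hsplit, hzero] at hdual
    linarith
  rw [← ENNReal.ofReal_natCast, ← ENNReal.ofReal_mul (by norm_num)]
  refine ENNReal.ofReal_le_ofReal (le_trans ?_ hopt)
  gcongr
  norm_num
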